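/- Write $2^{\mathbb N}$ for Cantor space, $T$ for the left shift $(T\omega)(n)=\omega(n+1)$, and $[\sigma]$ for the set of $\omega\in 2^{\mathbb N}$ extending the finite binary string $\sigma$. A \emph{representation} of a Borel probability measure $\mu$ on $2^{\mathbb N}$ is a function $f$ assigning to each finite binary string $\sigma$ and each $i\in\mathbb N$ a rational $f(\sigma,i)$ with $|\mu([\sigma])-f(\sigma,i)|<2^{-i}$. For $n\ge 1$, a set $A\subseteq\{0,\dots,n-1\}$ is identified with the binary string of length $n$ whose $i$th bit is $1$ iff $i\in A$; $D_A(\sigma)$ is $\frac1n$ times the number of $i<n$ such that for every $k<\mathrm{length}(\sigma)$ the $k$th bit of $\sigma$ equals bit $(i+k)\bmod n$ of $A$. The set $A$ is a \emph{$(j,\varepsilon)$-good approximation} to $\mu$ if $|\mu([\sigma])-D_A(\sigma)|<\varepsilon$ for every $\sigma$ of length at most $j$. Algorithms taking infinite inputs are oracle programs: a single program, independent of the input, which queries the input as an oracle. \textbf{Theorem.} (1) There are a computable function $m(j,\varepsilon)\in\mathbb N$ of $j\in\mathbb N$ and rational $\varepsilon>0$, and an algorithm, such that, given any representation of any $T$-invariant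 Borel probability measure $\mu$ on $2^{\mathbb N}$ as an oracle, the algorithm computes, on each input $n$, a set $A_n\subseteq\{0,\dots,n-1\}$ (as a binary string of length $n$), in such a way that for all $j$, all rational $\varepsilon>0$ and all $n\ge m(j,\varepsilon)$, the set $A_n$ is a $(j,\varepsilon)$-good approximation to $\mu$. (In particular $m(j,\varepsilon)\ge 1$.) (2) Conversely, there is an algorithm with the following property. Let $\mu$ be a Borel probability measure on $2^{\mathbb N}$, let $m(j,\varepsilon)\in\mathbb N$ be any function of $j\in\mathbb N$ and rational $\varepsilon>0$, with $m(j,\varepsilon)\ge1$, and let $A_n\subseteq\{0,\dots,n-1\}$ be any sequence of sets such that $A_n$ is a $(j,\varepsilon)$-good approximation to $\mu$ whenever $n\ge m(j,\varepsilon)$. Given $m$ and $(A_n)$ as oracles, the algorithm computes a representation of $\mu$. -/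

import Mathlib

namespace CantorApprox

/-! ### Algorithms with access to an oracle -/

/-- Programs for algorithms on natural numbers that may query an oracle `g : ℕ → ℕ`. The basic
instructions are those of partial recursive functions (compare `Nat.Partrec.Code`), together with
one instruction that calls the oracle. A program does not depend on the oracle. -/
inductive OracleCode : Type
  | zero : OracleCode
  | succ : OracleCode
  | left : OracleCode
  | right : OracleCode
  | oracle : OracleCode
  | pair : OracleCode → OracleCode → OracleCode
  | comp : OracleCode → OracleCode → OracleCode
  | prec : OracleCode → OracleCode → OracleCode
  | rfind : OracleCode → OracleCode

/-- The partial function computed by a program when it is run with the oracle `g`. The clauses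
are those of `Nat.RecursiveIn {g}`. -/
def OracleCode.eval (g : ℕ → ℕ) : OracleCode → ℕ →. ℕ
  | .zero => fun _ => Part.some 0
  | .succ => fun n => Part.some (n + 1)
  | .left => fun n => Part.some (Nat.unpair n).1
  | .right => fun n => Part.some (Nat.unpair n).2
  | .oracle => fun n => Part.some (g n)
  | .pair c d => fun n => Nat.pair <$> c.eval g n <*> d.eval g n
  | .comp c d => fun n => d.eval g n >>= c.eval g
  | .prec c d => fun p =>
      Nat.rec (c.eval g (Nat.unpair p).1)
        (fun y IH => IH >>= fun i => d.eval g (Nat.pair (Nat.unpair p).1 (Nat.pair y i)))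
        (Nat.unpair p).2
  | .rfind c => fun a => Nat.rfind fun n => (fun k => decide (k = 0)) <$> c.eval g (Nat.pair a n)

/-- The oracle that answers queries to `g` (even arguments) and to `h` (odd arguments). -/
def joinOracle (g h : ℕ → ℕ) : ℕ → ℕ :=
  fun n => if n % 2 = 0 then g (n / 2) else h (n / 2)

/-! ### Coding finite objects by natural numbers -/

/-- The code of a finite binary string. -/
def strCode (σ : List Bool) : ℕ := Encodable.encode σ

/-- The code of a rational number: numerator and denominator in lowest terms, the integer `k ≥ 0`
being coded by `2 k` and `-(k + 1)` by `2 k + 1`. -/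
def ratCode (q : ℚ) : ℕ := Nat.pair (Equiv.intEquivNat q.num) q.den

/-- The binary string of length `n` that is identified with the subset `A` of `{0, …, n - 1}`. -/
def charString (n : ℕ) (A : Finset ℕ) : List Bool :=
  (List.range n).map fun i => decide (i ∈ A)

/-! ### Cantor space and its measures -/

/-- The set of infinite binary sequences that extend the finite string `σ`. -/
def cylinder (σ : List Bool) : Set (ℕ → Bool) :=
  {ω | ∀ k : Fin σ.length, ω k = σ.get k}

/-- The left shift on infinite binary sequences. -/
def shift (ω : ℕ → Bool) : ℕ → Bool := fun n => ω (n + 1)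

/-- `f` is a representation of the measure `μ`: it gives, for every finite string `σ` and every
`i`, a rational approximation of the measure of `[σ]` to within `2⁻ⁱ`. -/
def IsRepresentation (μ : MeasureTheory.Measure (ℕ → Bool)) (f : List Bool → ℕ → ℚ) : Prop :=
  ∀ σ i, |μ.real (cylinder σ) - (f σ i : ℝ)| < ((2 : ℝ) ^ i)⁻¹

/-! ### Densities of strings in finite sets -/

/-- The set of positions `i < n` at which the string `σ` occurs (with wraparound) in `A`, seen as
a subset of `{0, …, n - 1}`. -/
def occurrences (n : ℕ) (A : Finset ℕ) (σ : List Bool) : Finset ℕ :=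
  (Finset.range n).filter fun i => ∀ k : Fin σ.length, σ.get k = decide ((i + k) % n ∈ A)

/-- The density of the occurrences of `σ` in the subset `A` of `{0, …, n - 1}`. -/
noncomputable def density (n : ℕ) (A : Finset ℕ) (σ : List Bool) : ℝ :=
  ((occurrences n A σ).card : ℝ) / n

/-- The subset `A` of `{0, …, n - 1}` is a `(j, ε)`-good approximation to `μ`. Densities make
sense for `n > 0` only. -/
def IsGoodApprox (μ : MeasureTheory.Measure (ℕ → Bool)) (j : ℕ) (ε : ℚ) (n : ℕ) (A : Finset ℕ) : Prop :=
  0 < n ∧ A ⊆ Finset.range n ∧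
    ∀ σ : List Bool, σ.length ≤ j → |μ.real (cylinder σ) - density n A σ| < (ε : ℝ)

/-- `(A n)` is a sequence of subsets `A n ⊆ {0, …, n - 1}` which are `(j, ε)`-good approximations
to `μ` from `m j ε` on, for all `j` and all rational `ε > 0`. -/
def IsGoodSequence (μ : MeasureTheory.Measure (ℕ → Bool)) (m : ℕ → {ε : ℚ // 0 < ε} → ℕ)
    (A : ℕ → Finset ℕ) : Prop :=
  (∀ n, A n ⊆ Finset.range n) ∧
    ∀ (j : ℕ) (ε : {ε : ℚ // 0 < ε}) (n : ℕ), m j ε ≤ n → IsGoodApprox μ j ε n (A n)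

/-! ### Which functions on `ℕ` present the objects above to an algorithm -/

/-- The (oracle or output) function `F` on codes gives the function `f`. -/
def CodesRepresentation (F : ℕ →. ℕ) (f : List Bool → ℕ → ℚ) : Prop :=
  ∀ σ i, F (Nat.pair (strCode σ) i) = Part.some (ratCode (f σ i))

/-- The (oracle or output) function `F` on codes gives the function `m`. -/
def CodesModulus (F : ℕ →. ℕ) (m : ℕ → {ε : ℚ // 0 < ε} → ℕ) : Prop :=
  ∀ (j : ℕ) (ε : {ε : ℚ // 0 < ε}), F (Nat.pair j (ratCode ε)) = Part.some (m j ε)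

/-- The (oracle or output) function `F` on codes gives the sequence of finite sets `A n`, each
presented in full by the binary string of length `n`. -/
def CodesSequence (F : ℕ →. ℕ) (A : ℕ → Finset ℕ) : Prop :=
  ∀ n, F n = Part.some (strCode (charString n (A n)))

end CantorApprox

/-! For (1), fix a block length k. Under an invariant measure every starting position in a random
word of length k sees σ with probability μ([σ]), as long as σ fits; by linearity of expectation σ
occurs k·μ([σ]) times on average, up to |σ| (`abs_sum_measureReal_mul_occ_sub_le`). Concatenating
about (n/k)·μ([w]) copies of each word w of length k therefore gives a string in which σ has nearly
the right density. The errors come from rounding the numbers of copies (order k·2^k), from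
occurrences across seams or the wraparound (order |σ| per block), and from adjusting the length to
n; `abs_card_occurrences_sub_le` adds them up. With k the largest integer such that k²·2^k ≤ n, the
total relative to n is of order (|σ|+1)/k. This bound does not involve μ, hence one computable
modulus serves all measures (`isGoodApprox_approxString`).

For (2), μ([σ]) is within 2^-(i+1) of the density of σ in A_n for n = m(|σ|, 2^-(i+1)), and this
density is rounded to a dyadic rational (`isRepresentation_approxMeasure`).

Uniformity in the oracle reduces to composition: all the combinatorics is primitive recursive, and
the oracle is met only through a finite list of questions in (1) (`list_map_oracle`) and through two
nested questions in (2). -/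

namespace CantorApprox

/-! ### Functions computed by oracle programs, uniformly in the oracle -/

/-- Every partial recursive function is computed by a program that ignores its oracle. -/
theorem OracleCode.exists_eval_eq {f : ℕ →. ℕ} (hf : Nat.Partrec f) :
    ∃ c : OracleCode, ∀ g, c.eval g = f := by
  induction hf with
  | zero => exact ⟨.zero, fun g => rfl⟩
  | succ => exact ⟨.succ, fun g => rfl⟩
  | left => exact ⟨.left, fun g => rfl⟩
  | right => exact ⟨.right, fun g => rfl⟩
  | pair _ _ hc hd =>
    obtain ⟨c, hc⟩ := hc
    obtain ⟨d, hd⟩ := hd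
    exact ⟨.pair c d, fun g => by simp only [OracleCode.eval, hc g, hd g]; rfl⟩
  | comp _ _ hc hd =>
    obtain ⟨c, hc⟩ := hc
    obtain ⟨d, hd⟩ := hd
    exact ⟨.comp c d, fun g => by simp only [OracleCode.eval, hc g, hd g]; rfl⟩
  | prec _ _ hc hd =>
    obtain ⟨c, hc⟩ := hc
    obtain ⟨d, hd⟩ := hd
    exact ⟨.prec c d, fun g => by simp only [OracleCode.eval, hc g, hd g]; rfl⟩
  | rfind _ hc =>
    obtain ⟨c, hc⟩ := hc
    exact ⟨.rfind c, fun g => by simp only [OracleCode.eval, hc g]; rfl⟩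

variable {α β γ : Type*} [Primcodable α] [Primcodable β] [Primcodable γ]

/-- A total function which depends on an oracle is uniformly computable if a single program
computes it (on codes) for all oracles. -/
def UniformlyComputable (φ : (ℕ → ℕ) → α → β) : Prop :=
  ∃ c : OracleCode, ∀ g a, c.eval g (Encodable.encode a) = Part.some (Encodable.encode (φ g a))

namespace UniformlyComputable

theorem of_computable {f : α → β} (hf : Computable f) :
    UniformlyComputable fun _ a => f a := by
  obtain ⟨c, hc⟩ := OracleCode.exists_eval_eq hf
  exact ⟨c, fun g a => by rw [hc]; simp⟩

theorem oracle : UniformlyComputable fun (g : ℕ → ℕ) (n : ℕ) => g n :=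
  ⟨.oracle, fun _ _ => rfl⟩

theorem comp {φ : (ℕ → ℕ) → β → γ} {ψ : (ℕ → ℕ) → α → β} (hφ : UniformlyComputable φ)
    (hψ : UniformlyComputable ψ) : UniformlyComputable fun g a => φ g (ψ g a) := by
  obtain ⟨c, hc⟩ := hφ
  obtain ⟨d, hd⟩ := hψ
  refine ⟨.comp c d, fun g a => ?_⟩
  simp only [OracleCode.eval, hd]
  exact (Part.bind_some _ _).trans (hc g _)

theorem pair {φ : (ℕ → ℕ) → α → β} {ψ : (ℕ → ℕ) → α → γ} (hφ : UniformlyComputable φ)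
    (hψ : UniformlyComputable ψ) : UniformlyComputable fun g a => (φ g a, ψ g a) := by
  obtain ⟨c, hc⟩ := hφ
  obtain ⟨d, hd⟩ := hψ
  refine ⟨.pair c d, fun g a => ?_⟩
  simp [OracleCode.eval, hc, hd, Seq.seq]

theorem prec {φ : (ℕ → ℕ) → α → β} {ψ : (ℕ → ℕ) → α × ℕ × β → β} (hφ : UniformlyComputable φ)
    (hψ : UniformlyComputable ψ) :
    UniformlyComputable fun g (p : α × ℕ) =>
      (Nat.rec (φ g p.1) (fun y i => ψ g (p.1, y, i)) p.2 : β) := by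
  obtain ⟨c, hc⟩ := hφ
  obtain ⟨d, hd⟩ := hψ
  refine ⟨.prec c d, fun g p => ?_⟩
  obtain ⟨a, n⟩ := p
  simp only [OracleCode.eval, Encodable.encode_prod_val, Nat.unpair_pair, Encodable.encode_nat]
  induction n with
  | zero => exact hc g a
  | succ n ih =>
    simp only [ih]
    refine (Part.bind_some _ _).trans ?_
    simpa using hd g (a, n, _)

/-- A program can put a whole list of questions to its oracle. -/
theorem list_map_oracle : UniformlyComputable fun (g : ℕ → ℕ) (l : List ℕ) => l.map g := by
  have hq : UniformlyComputable fun g (p : List ℕ × ℕ × List ℕ) => g (p.1.getI p.2.1) :=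
    oracle.comp (of_computable (Primrec.list_getI.comp Primrec.fst
      (Primrec.fst.comp Primrec.snd)).to_comp)
  have hs : UniformlyComputable fun g (p : List ℕ × ℕ × List ℕ) =>
      p.2.2 ++ [g (p.1.getI p.2.1)] :=
    (of_computable (Primrec.list_concat.comp (Primrec.fst (α := List ℕ) (β := ℕ))
      Primrec.snd).to_comp).comp
      ((of_computable (Primrec.snd.comp Primrec.snd).to_comp).pair hq)
  have hr := ((of_computable (Computable.const ([] : List ℕ))).prec hs).comp
    (of_computable (Primrec.id.pair Primrec.list_length).to_comp)
  -- The recursion accumulates the answers to the first n questions; the bound on n keeps the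
  -- default value of `getI` out of play.
  have key : ∀ (g : ℕ → ℕ) (l : List ℕ) (n : ℕ), n ≤ l.length →
      (Nat.rec [] (fun y i => i ++ [g (l.getI y)]) n : List ℕ) = (l.take n).map g := by
    intro g l n hn
    induction n with
    | zero => simp
    | succ n ih =>
      simp only [ih (by omega)]
      rw [List.take_succ_eq_append_getElem (by omega), List.getI_eq_getElem _ (by omega),
        List.map_append, List.map_cons, List.map_nil]
  obtain ⟨c, hc⟩ := hr
  refine ⟨c, fun g l => (hc g l).trans ?_⟩
  have := key g l l.length le_rfl
  simp only [id, this, List.take_length]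

end UniformlyComputable

/-! ### Counting occurrences in finite strings -/

/-- The number of occurrences (without wraparound) of `σ` in a finite string, an empty `σ`
occurring once at each position. -/
def occ (σ : List Bool) : List Bool → ℕ
  | [] => 0
  | a :: s => occ σ s + if σ <+: a :: s then 1 else 0

theorem occ_le_length (σ s : List Bool) : occ σ s ≤ s.length := by
  induction s with
  | nil => simp [occ]
  | cons a s ih => simp only [occ, List.length_cons]; split_ifs <;> omega

theorem occ_eq_sum (σ s : List Bool) :
    occ σ s = ∑ i ∈ Finset.range s.length, if σ <+: s.drop i then 1 else 0 := by
  induction s with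
  | nil => simp [occ]
  | cons a s ih => simp only [occ, ih, List.length_cons, Finset.sum_range_succ', List.drop_succ_cons,
      List.drop_zero]

theorem occ_le_occ_append (σ s t : List Bool) : occ σ s + occ σ t ≤ occ σ (s ++ t) := by
  induction s with
  | nil => simp [occ]
  | cons a s ih =>
    simp only [occ, List.cons_append]
    split_ifs with h h'
    · omega
    · exact absurd (h.trans (List.prefix_append (a :: s) t)) h'
    · omega
    · omega

/-- Only occurrences that straddle the seam are new. The minimum makes the induction work: a new
occurrence at the head must run past the end of `a :: s`, which forces σ to be longer than it, so
the minimum grows by one exactly when it is needed. -/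
theorem occ_append_le_min (σ s t : List Bool) :
    occ σ (s ++ t) ≤ occ σ s + occ σ t + min s.length σ.length := by
  induction s with
  | nil => simp [occ]
  | cons a s ih =>
    simp only [occ, List.cons_append, List.length_cons]
    split_ifs with h h' h'
    · omega
    · have : s.length + 1 < σ.length := by
        by_contra hlt
        exact h' (List.prefix_of_prefix_length_le h (List.prefix_append (a :: s) t)
          (by simp only [List.length_cons]; omega))
      omega
    · omega
    · omega

theorem occ_append_le (σ s t : List Bool) :
    occ σ (s ++ t) ≤ occ σ s + occ σ t + σ.length :=
  (occ_append_le_min σ s t).trans (by omega)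

/-- The concatenation of `c t` copies of each of the strings `w t`, for `t < K`. -/
def blocks (c : ℕ → ℕ) (w : ℕ → List Bool) (K : ℕ) : List Bool :=
  (List.range K).flatMap fun t => (List.range (c t)).flatMap fun _ => w t

theorem flatMap_range_const_succ (w : List Bool) (c : ℕ) :
    ((List.range (c + 1)).flatMap fun _ => w) = ((List.range c).flatMap fun _ => w) ++ w := by
  simp [List.range_succ]

theorem blocks_succ (c : ℕ → ℕ) (w : ℕ → List Bool) (K : ℕ) :
    blocks c w (K + 1) = blocks c w K ++ (List.range (c K)).flatMap fun _ => w K := by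
  simp [blocks, List.range_succ]

theorem length_flatMap_range_const (w : List Bool) (c : ℕ) :
    ((List.range c).flatMap fun _ => w).length = c * w.length := by
  induction c with
  | zero => simp
  | succ c ih => rw [flatMap_range_const_succ, List.length_append, ih]; ring

theorem length_blocks {c : ℕ → ℕ} {w : ℕ → List Bool} {k : ℕ} (hw : ∀ t, (w t).length = k)
    (K : ℕ) : (blocks c w K).length = (∑ t ∈ Finset.range K, c t) * k := by
  induction K with
  | zero => simp [blocks]
  | succ K ih =>
    rw [blocks_succ, List.length_append, ih, length_flatMap_range_const, Finset.sum_range_succ,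
      hw, add_mul]

theorem mul_occ_le (σ w : List Bool) (c : ℕ) :
    c * occ σ w ≤ occ σ ((List.range c).flatMap fun _ => w) := by
  induction c with
  | zero => simp
  | succ c ih =>
    rw [flatMap_range_const_succ]
    have := occ_le_occ_append σ ((List.range c).flatMap fun _ => w) w
    rw [add_mul]
    omega

theorem occ_le_mul (σ w : List Bool) (c : ℕ) :
    occ σ ((List.range c).flatMap fun _ => w) ≤ c * occ σ w + c * σ.length := by
  induction c with
  | zero => simp [occ]
  | succ c ih =>
    rw [flatMap_range_const_succ]
    have := occ_append_le σ ((List.range c).flatMap fun _ => w) w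
    rw [add_mul, add_mul]
    omega

theorem sum_le_occ_blocks (σ : List Bool) (c : ℕ → ℕ) (w : ℕ → List Bool) (K : ℕ) :
    ∑ t ∈ Finset.range K, c t * occ σ (w t) ≤ occ σ (blocks c w K) := by
  induction K with
  | zero => simp
  | succ K ih =>
    rw [blocks_succ, Finset.sum_range_succ]
    have := occ_le_occ_append σ (blocks c w K) ((List.range (c K)).flatMap fun _ => w K)
    have := mul_occ_le σ (w K) (c K)
    omega

theorem occ_blocks_le (σ : List Bool) (c : ℕ → ℕ) (w : ℕ → List Bool) (K : ℕ) :
    occ σ (blocks c w K) ≤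
      ∑ t ∈ Finset.range K, c t * occ σ (w t) +
        (∑ t ∈ Finset.range K, c t + K) * σ.length := by
  induction K with
  | zero => simp [blocks, occ]
  | succ K ih =>
    rw [blocks_succ, Finset.sum_range_succ, Finset.sum_range_succ]
    have := occ_append_le σ (blocks c w K) ((List.range (c K)).flatMap fun _ => w K)
    have := occ_le_mul σ (w K) (c K)
    linarith

/-- The string of length `n` obtained from `s` by truncation or by padding with zeros. -/
def fit (n : ℕ) (s : List Bool) : List Bool :=
  (s ++ (List.range n).map fun _ => false).take n

theorem length_fit (n : ℕ) (s : List Bool) : (fit n s).length = n := by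
  simp [fit]

/-- Truncation creates no occurrences, and padding creates at most one per added position and |σ| at
the seam. The truncated subtraction vanishes when no padding takes place. -/
theorem occ_fit_le (σ : List Bool) (n : ℕ) (s : List Bool) :
    occ σ (fit n s) ≤ occ σ s + (n - s.length) + σ.length := by
  rcases le_total n s.length with h | h
  · have := occ_le_occ_append σ (s.take n) (s.drop n)
    rw [List.take_append_drop] at this
    rw [fit, List.take_append_of_le_length h]
    omega
  · rw [fit, List.take_append, List.take_of_length_le h]
    refine (occ_append_le _ _ _).trans ?_
    have := occ_le_length σ (((List.range n).map fun _ => false).take (n - s.length))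
    simp only [List.length_take, List.length_map, List.length_range] at this
    omega

theorem occ_le_occ_fit (σ : List Bool) (n : ℕ) (s : List Bool) :
    occ σ s ≤ occ σ (fit n s) + (s.length - n) + σ.length := by
  rcases le_total n s.length with h | h
  · have := occ_append_le σ (s.take n) (s.drop n)
    have h' := occ_le_length σ (s.drop n)
    rw [List.take_append_drop] at this
    rw [List.length_drop] at h'
    rw [fit, List.take_append_of_le_length h]
    omega
  · rw [fit, List.take_append, List.take_of_length_le h]
    have := occ_le_occ_append σ s (((List.range n).map fun _ => false).take (n - s.length))
    omega

theorem prefix_drop_iff (σ s : List Bool) (i : ℕ) :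
    σ <+: s.drop i ↔ ∀ k : Fin σ.length, s[i + k]? = some (σ.get k) := by
  rw [List.prefix_iff_getElem?]
  simp only [List.getElem?_drop, List.get_eq_getElem]
  exact ⟨fun h k => h k k.2, fun h k hk => h ⟨k, hk⟩⟩

/-- The subset of `{0, …, n - 1}` that is identified with the string `s` of length `n`. -/
def stringSet (s : List Bool) : Finset ℕ :=
  (Finset.range s.length).filter fun i => s[i]? = some true

theorem mem_stringSet {s : List Bool} {i : ℕ} : i ∈ stringSet s ↔ s[i]? = some true := by
  simp only [stringSet, Finset.mem_filter, Finset.mem_range, and_iff_right_iff_imp]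
  intro h
  by_contra hi
  rw [List.getElem?_eq_none (by omega)] at h
  cases h

theorem getElem?_eq_decide {s : List Bool} {i : ℕ} (hi : i < s.length) :
    s[i]? = some (decide (i ∈ stringSet s)) := by
  rw [List.getElem?_eq_getElem hi]
  cases h : s[i] <;> simp [mem_stringSet, List.getElem?_eq_getElem hi, h]

theorem charString_stringSet (s : List Bool) : charString s.length (stringSet s) = s := by
  refine List.ext_getElem? fun i => ?_
  rcases lt_or_ge i s.length with hi | hi
  · rw [getElem?_eq_decide hi]
    simp [charString, hi]
  · rw [List.getElem?_eq_none hi, List.getElem?_eq_none (by simpa [charString] using hi)]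

theorem occ_le_card_occurrences (σ s : List Bool) :
    occ σ s ≤ (occurrences s.length (stringSet s) σ).card := by
  rw [occ_eq_sum, ← Finset.card_filter]
  refine Finset.card_le_card fun i hi => ?_
  simp only [Finset.mem_filter, Finset.mem_range, prefix_drop_iff, occurrences] at hi ⊢
  refine ⟨hi.1, fun k => ?_⟩
  have h := hi.2 k
  have hlt : i + k < s.length := by
    by_contra hlt
    rw [List.getElem?_eq_none (by omega)] at h
    cases h
  rw [getElem?_eq_decide hlt] at h
  rw [Nat.mod_eq_of_lt hlt]
  exact (Option.some.inj h).symm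

/-- An occurrence that wraps around starts among the last |σ| positions. -/
theorem card_occurrences_le (σ s : List Bool) :
    (occurrences s.length (stringSet s) σ).card ≤ occ σ s + σ.length := by
  rw [occ_eq_sum, ← Finset.card_filter]
  have hsub : occurrences s.length (stringSet s) σ ⊆
      (Finset.range s.length).filter (fun i => σ <+: s.drop i) ∪
        Finset.Ico (s.length - σ.length) s.length := by
    intro i hi
    simp only [Finset.mem_union, Finset.mem_filter, Finset.mem_range, prefix_drop_iff, occurrences,
      Finset.mem_Ico] at hi ⊢
    rcases lt_or_ge s.length (i + σ.length) with h | h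
    · exact Or.inr ⟨by omega, hi.1⟩
    · refine Or.inl ⟨hi.1, fun k => ?_⟩
      have hlt : i + k < s.length := by omega
      rw [getElem?_eq_decide hlt, hi.2 k, Nat.mod_eq_of_lt hlt]
  refine (Finset.card_le_card hsub).trans ((Finset.card_union_le _ _).trans ?_)
  rw [Nat.card_Ico]
  omega

/-! ### The strings of a given length as blocks -/

/-- The string of length `k` whose bits are the last `k` binary digits of `t`. -/
def word (k t : ℕ) : List Bool := (List.range k).map fun b => t.testBit b

theorem length_word (k t : ℕ) : (word k t).length = k := by simp [word]

theorem mem_cylinder_word {k t : ℕ} {ω : ℕ → Bool} :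
    ω ∈ cylinder (word k t) ↔ ∀ b < k, ω b = t.testBit b := by
  simp only [cylinder, Set.mem_ofPred_eq]
  refine ⟨fun h b hb => ?_, fun h b => ?_⟩
  · have := h ⟨b, by simpa [length_word] using hb⟩
    simpa [word] using this
  · have hb : (b : ℕ) < k := by simpa [length_word] using b.2
    rw [List.get_eq_getElem, h b hb]
    simp [word]

theorem prefix_drop_word_iff (σ : List Bool) (k t i : ℕ) :
    σ <+: (word k t).drop i ↔
      ∀ b : Fin σ.length, i + b < k ∧ t.testBit (i + b) = σ.get b := by
  rw [prefix_drop_iff]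
  refine forall_congr' fun b => ?_
  rcases lt_or_ge (i + (b : ℕ)) k with h | h
  · simp [word, h]
  · rw [List.getElem?_eq_none (by simpa [length_word] using h)]
    simp [h]

theorem exists_mem_cylinder_word (k : ℕ) (ω : ℕ → Bool) :
    ∃ t < 2 ^ k, ω ∈ cylinder (word k t) :=
  ⟨Nat.ofBits fun b : Fin k => ω b, Nat.ofBits_lt_two_pow _, mem_cylinder_word.2 fun b hb => by
    rw [Nat.testBit_ofBits_lt _ _ hb]⟩

theorem eq_of_mem_cylinder_word {k t u : ℕ} {ω : ℕ → Bool} (ht : t < 2 ^ k) (hu : u < 2 ^ k)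
    (h : ω ∈ cylinder (word k t)) (h' : ω ∈ cylinder (word k u)) : t = u := by
  rw [mem_cylinder_word] at h h'
  refine Nat.eq_of_testBit_eq fun b => ?_
  rcases lt_or_ge b k with hb | hb
  · rw [← h b hb, h' b hb]
  · have hk := Nat.pow_le_pow_right (n := 2) (by norm_num) hb
    rw [Nat.testBit_lt_two_pow (ht.trans_le hk), Nat.testBit_lt_two_pow (hu.trans_le hk)]

theorem measurableSet_cylinder (σ : List Bool) : MeasurableSet (cylinder σ) := by
  have : cylinder σ = ⋂ k : Fin σ.length, (fun ω : ℕ → Bool => ω k) ⁻¹' {σ.get k} := by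
    ext ω; simp [cylinder]
  rw [this]
  exact MeasurableSet.iInter fun k => measurable_pi_apply _ (MeasurableSet.singleton _)

theorem shift_iterate_apply (i : ℕ) (ω : ℕ → Bool) (b : ℕ) : (shift^[i] ω) b = ω (i + b) := by
  induction i generalizing ω with
  | zero => simp
  | succ i ih => rw [Function.iterate_succ_apply, ih, shift]; congr 1; omega

/-- Whether σ occurs at position i is decided by the first k bits when it fits into them. -/
theorem preimage_shift_iterate_cylinder {σ : List Bool} {k i : ℕ} (hi : i + σ.length ≤ k) :
    shift^[i] ⁻¹' cylinder σ =
      ⋃ t ∈ (Finset.range (2 ^ k)).filter fun t => σ <+: (word k t).drop i,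
        cylinder (word k t) := by
  ext ω
  simp only [Set.mem_preimage, Set.mem_iUnion, Finset.mem_filter, Finset.mem_range,
    prefix_drop_word_iff, exists_prop]
  constructor
  · intro h
    obtain ⟨t, ht, hω⟩ := exists_mem_cylinder_word k ω
    refine ⟨t, ⟨ht, fun b => ⟨by omega, ?_⟩⟩, hω⟩
    rw [← mem_cylinder_word.1 hω (i + b) (by omega), ← shift_iterate_apply i ω]
    exact h b
  · rintro ⟨t, ⟨-, h⟩, hω⟩ b
    rw [shift_iterate_apply, mem_cylinder_word.1 hω _ (h b).1, (h b).2]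

/-! ### Expected and actual numbers of occurrences for an invariant measure -/

section Measure

open MeasureTheory

variable {μ : Measure (ℕ → Bool)} [IsProbabilityMeasure μ]

/-- This is where invariance enters: the sum is the measure of the preimage of [σ] under the i-th
iterate of the shift, cut into disjoint cylinders of length k. -/
theorem sum_measureReal_cylinder_prefix (hμ : MeasurePreserving shift μ μ) {σ : List Bool}
    {k i : ℕ} (hi : i + σ.length ≤ k) :
    ∑ t ∈ Finset.range (2 ^ k),
      μ.real (cylinder (word k t)) * (if σ <+: (word k t).drop i then 1 else 0) =
        μ.real (cylinder σ) := by
  simp only [mul_ite, mul_one, mul_zero]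
  rw [← Finset.sum_filter, ← (hμ.iterate i).measureReal_preimage
    (measurableSet_cylinder σ).nullMeasurableSet, preimage_shift_iterate_cylinder hi,
    measureReal_biUnion_finset]
  · intro t ht u hu htu
    simp only [Finset.coe_filter, Finset.mem_range, Set.mem_ofPred_eq] at ht hu
    exact Set.disjoint_left.2 fun ω h h' => htu (eq_of_mem_cylinder_word ht.1 hu.1 h h')
  · exact fun t _ => measurableSet_cylinder _

theorem sum_measureReal_cylinder_word (μ : Measure (ℕ → Bool)) [IsProbabilityMeasure μ] (k : ℕ) :
    ∑ t ∈ Finset.range (2 ^ k), μ.real (cylinder (word k t)) = 1 := by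
  have h : (Set.univ : Set (ℕ → Bool)) = ⋃ t ∈ Finset.range (2 ^ k), cylinder (word k t) := by
    ext ω
    simpa using exists_mem_cylinder_word k ω
  rw [← measureReal_biUnion_finset, ← h, probReal_univ]
  · intro t ht u hu htu
    simp only [Finset.coe_range, Set.mem_Iio] at ht hu
    exact Set.disjoint_left.2 fun ω h h' => htu (eq_of_mem_cylinder_word ht hu h h')
  · exact fun t _ => measurableSet_cylinder _

/-- The expected number of occurrences of `σ` in a random string of length `k`. -/
theorem abs_sum_measureReal_mul_occ_sub_le (hμ : MeasurePreserving shift μ μ) (σ : List Bool)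
    (k : ℕ) :
    |∑ t ∈ Finset.range (2 ^ k), μ.real (cylinder (word k t)) * occ σ (word k t) -
      k * μ.real (cylinder σ)| ≤ σ.length := by
  -- Positions where σ fits contribute no error. At the others σ cannot occur, and the error is
  -- μ([σ]) ≤ 1; there are at most |σ| of them.
  have hterm : ∀ i ∈ Finset.range k, |∑ t ∈ Finset.range (2 ^ k),
      μ.real (cylinder (word k t)) * (if σ <+: (word k t).drop i then (1 : ℝ) else 0) -
        μ.real (cylinder σ)| ≤ if k < i + σ.length then 1 else 0 := by
    intro i _
    split_ifs with h
    · rw [Finset.sum_eq_zero, zero_sub, abs_neg, abs_of_nonneg measureReal_nonneg]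
      · exact measureReal_le_one
      · intro t _
        rw [if_neg, mul_zero]
        intro hp
        have := hp.length_le
        have hl := length_word k t
        rw [List.length_drop] at this
        have := Finset.mem_range.1 ‹i ∈ Finset.range k›
        omega
    · rw [sum_measureReal_cylinder_prefix hμ (not_lt.1 h), sub_self, abs_zero]
  have heq : ∑ t ∈ Finset.range (2 ^ k), μ.real (cylinder (word k t)) * occ σ (word k t) -
      k * μ.real (cylinder σ) = ∑ i ∈ Finset.range k, (∑ t ∈ Finset.range (2 ^ k),
      μ.real (cylinder (word k t)) * (if σ <+: (word k t).drop i then (1 : ℝ) else 0) -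
        μ.real (cylinder σ)) := by
    rw [Finset.sum_sub_distrib, Finset.sum_comm]
    simp only [occ_eq_sum, length_word, Nat.cast_sum, Finset.mul_sum, Nat.cast_ite, Nat.cast_one,
      Nat.cast_zero, Finset.sum_const, Finset.card_range, nsmul_eq_mul]
  rw [heq]
  refine (Finset.abs_sum_le_sum_abs _ _).trans ((Finset.sum_le_sum hterm).trans ?_)
  rw [← Finset.sum_filter, Finset.sum_const, nsmul_eq_mul, mul_one, Nat.cast_le]
  have hsub : (Finset.range k).filter (fun i => k < i + σ.length) ⊆ Finset.Ico (k - σ.length) k := by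
    intro i hi
    simp only [Finset.mem_filter, Finset.mem_range, Finset.mem_Ico] at hi ⊢
    omega
  refine (Finset.card_le_card hsub).trans ?_
  rw [Nat.card_Ico]
  omega

/-- A concatenation of strings of length `k`, each taken with approximately the frequency
prescribed by an invariant measure, has approximately the right densities. -/
theorem abs_card_occurrences_sub_le (hμ : MeasurePreserving shift μ μ) {n k : ℕ}
    (hk : 0 < k) {c : ℕ → ℕ} (hc : ∀ t < 2 ^ k,
      |(c t : ℝ) - (n / k : ℕ) * μ.real (cylinder (word k t))| ≤ 2) (σ : List Bool) :
    |((occurrences n (stringSet (fit n (blocks c (word k) (2 ^ k)))) σ).card : ℝ) -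
      n * μ.real (cylinder σ)| ≤
        4 * (k * 2 ^ k) + 2 * k + (2 * (n / k : ℕ) + 3 * 2 ^ k + 2) * σ.length := by
  have hlen : (fit n (blocks c (word k) (2 ^ k))).length = n := length_fit _ _
  have h1 := occ_le_card_occurrences σ (fit n (blocks c (word k) (2 ^ k)))
  have h2 := card_occurrences_le σ (fit n (blocks c (word k) (2 ^ k)))
  rw [hlen] at h1 h2
  have h3 := occ_fit_le σ n (blocks c (word k) (2 ^ k))
  have h4 := occ_le_occ_fit σ n (blocks c (word k) (2 ^ k))
  have h5 := sum_le_occ_blocks σ c (word k) (2 ^ k)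
  have h6 := occ_blocks_le σ c (word k) (2 ^ k)
  have hl := length_blocks (c := c) (length_word k) (2 ^ k)
  have hN1 : n / k * k ≤ n := Nat.div_mul_le_self n k
  have hN2 : n ≤ n / k * k + k := by
    have := Nat.div_add_mod' n k
    have := Nat.mod_lt n hk
    omega
  generalize n / k = N at *
  -- Each of the 2^k words has a miscount of at most 2 copies, each copy with at most k occurrences.
  have hocc : |(∑ t ∈ Finset.range (2 ^ k), (c t : ℝ) * occ σ (word k t)) -
      N * ∑ t ∈ Finset.range (2 ^ k), μ.real (cylinder (word k t)) * occ σ (word k t)| ≤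
        2 ^ k * (2 * k) := by
    rw [Finset.mul_sum, ← Finset.sum_sub_distrib]
    refine (Finset.abs_sum_le_sum_abs _ _).trans
      ((Finset.sum_le_card_nsmul _ _ (2 * (k : ℝ)) fun t ht => ?_).trans (by simp))
    rw [← mul_assoc, ← sub_mul, abs_mul, Nat.abs_cast]
    have : (occ σ (word k t) : ℝ) ≤ k := by
      have := occ_le_length σ (word k t)
      rw [length_word] at this
      exact_mod_cast this
    exact mul_le_mul (hc t (Finset.mem_range.1 ht)) this (Nat.cast_nonneg _) (by norm_num)
  -- As the cylinders have total measure 1, the number of blocks is N up to rounding; this controls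
  -- both the seams and the length.
  have hsum : |(∑ t ∈ Finset.range (2 ^ k), (c t : ℝ)) - N| ≤ 2 ^ k * 2 := by
    have hN : (N : ℝ) = ∑ t ∈ Finset.range (2 ^ k), N * μ.real (cylinder (word k t)) := by
      rw [← Finset.mul_sum, sum_measureReal_cylinder_word, mul_one]
    rw [hN, ← Finset.sum_sub_distrib]
    exact (Finset.abs_sum_le_sum_abs _ _).trans
      ((Finset.sum_le_card_nsmul _ _ 2 fun t ht => hc t (Finset.mem_range.1 ht)).trans (by simp))
  have hexp := abs_sum_measureReal_mul_occ_sub_le hμ σ k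
  have hexpN := mul_le_mul_of_nonneg_left hexp (Nat.cast_nonneg (α := ℝ) N)
  have hσ0 : 0 ≤ μ.real (cylinder σ) := measureReal_nonneg
  have hσ1 : μ.real (cylinder σ) ≤ 1 := measureReal_le_one
  rw [hl] at h3 h4
  have h3' : occ σ (fit n (blocks c (word k) (2 ^ k))) ≤ occ σ (blocks c (word k) (2 ^ k)) +
      σ.length + (n - (∑ t ∈ Finset.range (2 ^ k), c t) * k) := by omega
  have h4' : occ σ (blocks c (word k) (2 ^ k)) ≤ occ σ (fit n (blocks c (word k) (2 ^ k))) +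
      σ.length + ((∑ t ∈ Finset.range (2 ^ k), c t) * k - n) := by omega
  generalize hS : ∑ t ∈ Finset.range (2 ^ k), μ.real (cylinder (word k t)) * occ σ (word k t) = S at *
  have hCr : (∑ t ∈ Finset.range (2 ^ k), (c t : ℝ)) =
    ((∑ t ∈ Finset.range (2 ^ k), c t : ℕ) : ℝ) := by push_cast; rfl
  have hWr : (∑ t ∈ Finset.range (2 ^ k), (c t : ℝ) * occ σ (word k t)) =
    ((∑ t ∈ Finset.range (2 ^ k), c t * occ σ (word k t) : ℕ) : ℝ) := by push_cast; rfl
  rw [hCr] at hsum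
  rw [hWr] at hocc
  generalize ∑ t ∈ Finset.range (2 ^ k), c t = C at *
  generalize ∑ t ∈ Finset.range (2 ^ k), c t * occ σ (word k t) = W at *
  generalize occ σ (fit n (blocks c (word k) (2 ^ k))) = x at *
  generalize occ σ (blocks c (word k) (2 ^ k)) = y at *
  generalize (occurrences n (stringSet (fit n (blocks c (word k) (2 ^ k)))) σ).card = z at *
  generalize μ.real (cylinder σ) = p at *
  generalize σ.length = l at *
  have hk0 : (0 : ℝ) ≤ k := Nat.cast_nonneg k
  have hl0 : (0 : ℝ) ≤ l := Nat.cast_nonneg l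
  have hN1r : (N : ℝ) * k ≤ n := by exact_mod_cast hN1
  have hN2r : (n : ℝ) ≤ N * k + k := by exact_mod_cast hN2
  rw [abs_le] at hsum hocc
  have e1 := mul_le_mul_of_nonneg_right hsum.1 hk0
  have e2 := mul_le_mul_of_nonneg_right hsum.2 hk0
  have hd1 : ((n - C * k : ℕ) : ℝ) ≤ 2 * (k * 2 ^ k) + k := by
    rcases le_total n (C * k) with h | h
    · rw [Nat.sub_eq_zero_of_le h]; push_cast; positivity
    · rw [Nat.cast_sub h]; push_cast; linarith
  have hd2 : ((C * k - n : ℕ) : ℝ) ≤ 2 * (k * 2 ^ k) + k := by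
    rcases le_total (C * k) n with h | h
    · rw [Nat.sub_eq_zero_of_le h]; push_cast; positivity
    · rw [Nat.cast_sub h]; push_cast; linarith
  have h1r : (x : ℝ) ≤ z := by exact_mod_cast h1
  have h2r : (z : ℝ) ≤ x + l := by exact_mod_cast h2
  have h3r : (x : ℝ) ≤ y + l + ((n - C * k : ℕ) : ℝ) := by exact_mod_cast h3'
  have h4r : (y : ℝ) ≤ x + l + ((C * k - n : ℕ) : ℝ) := by exact_mod_cast h4'
  have h5r : (W : ℝ) ≤ y := by exact_mod_cast h5
  have h6r : (y : ℝ) ≤ W + (C + 2 ^ k) * l := by exact_mod_cast h6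
  have hClr := mul_le_mul_of_nonneg_right hsum.2 hl0
  have hnp1 : (N * k - n : ℝ) * p ≤ 0 := mul_nonpos_of_nonpos_of_nonneg (by linarith) hσ0
  have hnp2 : (n - N * k : ℝ) * p ≤ k * 1 := mul_le_mul (by linarith) hσ1 hσ0 hk0
  have hS1 : (N : ℝ) * (S - k * p) ≤ N * l :=
    (mul_le_mul_of_nonneg_left (le_abs_self _) (Nat.cast_nonneg _)).trans hexpN
  have hS2 : (N : ℝ) * -(S - k * p) ≤ N * l :=
    (mul_le_mul_of_nonneg_left (neg_le_abs _) (Nat.cast_nonneg _)).trans hexpN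
  have hpl : (0 : ℝ) ≤ 2 ^ k * l := by positivity
  have hNl : (0 : ℝ) ≤ N * l := by positivity
  -- Origin of the constants: k·2^k appears twice from rounding (`hocc`) and twice from fitting the
  -- length (`hd1`, `hd2`); k appears once from fitting and once from replacing N·k by n. The
  -- multiples of l are N from the expectation, at most N + 3·2^k from the seams, and 2 from fitting
  -- and wraparound.
  rw [abs_le]
  constructor <;> nlinarith

end Measure

/-! ### Rounding coded rationals to numbers of copies -/

theorem ratCode_of_nonneg {q : ℚ} (hq : 0 ≤ q) :
    ratCode q = Nat.pair (2 * q.num.toNat) q.den := by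
  obtain ⟨a, ha⟩ := Int.eq_ofNat_of_zero_le (Rat.num_nonneg.2 hq)
  rw [ratCode, ha]
  rfl

theorem ratCode_of_neg {q : ℚ} (hq : q < 0) : ∃ b, ratCode q = Nat.pair (2 * b + 1) q.den := by
  obtain ⟨b, hb⟩ := Int.eq_negSucc_of_lt_zero (Rat.num_neg.2 hq)
  refine ⟨b, ?_⟩
  rw [ratCode, hb]
  rfl

/-- The integer part of `N * q`, where `q` is the rational number with code `x`, and zero if `q` is
negative. -/
def copies (N x : ℕ) : ℕ :=
  if x.unpair.1 % 2 = 0 then x.unpair.1 / 2 * N / x.unpair.2 else 0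

theorem abs_natDiv_sub_le_one (a d : ℕ) (hd : 0 < d) :
    ((a / d : ℕ) : ℝ) ≤ a / d ∧ (a / d : ℝ) < (a / d : ℕ) + 1 := by
  refine ⟨Nat.cast_div_le, ?_⟩
  rw [div_lt_iff₀ (by exact_mod_cast hd)]
  exact_mod_cast (Nat.div_lt_iff_lt_mul hd).1 (Nat.lt_succ_self (a / d))

/-- Precision 2^-n suffices because N ≤ n ≤ 2^n, so that N·q is off by at most 1; the integer part
costs at most 1 more. If q is negative, then N·r ≤ 1 and zero copies will do. -/
theorem abs_copies_sub_le {N n : ℕ} (hN : N ≤ n) {r : ℝ} (hr : 0 ≤ r) {q : ℚ}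
    (hq : |r - q| < ((2 : ℝ) ^ n)⁻¹) : |(copies N (ratCode q) : ℝ) - N * r| ≤ 2 := by
  have hNr : |(N : ℝ) * r - N * q| ≤ 1 := by
    rw [← mul_sub, abs_mul, Nat.abs_cast]
    have hNn : (N : ℝ) ≤ 2 ^ n := by exact_mod_cast hN.trans Nat.lt_two_pow_self.le
    calc (N : ℝ) * |r - q| ≤ 2 ^ n * ((2 : ℝ) ^ n)⁻¹ :=
          mul_le_mul hNn hq.le (abs_nonneg _) (by positivity)
      _ = 1 := mul_inv_cancel₀ (by positivity)
  rw [abs_le] at hNr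
  rcases le_or_gt 0 q with h0 | h0
  · have hc : copies N (ratCode q) = q.num.toNat * N / q.den := by
      simp [copies, ratCode_of_nonneg h0]
    have hqr : (q : ℝ) = (q.num.toNat : ℝ) / q.den := by
      have h1 : ((q.num.toNat : ℤ) : ℝ) = (q.num : ℝ) := by
        rw [Int.toNat_of_nonneg (Rat.num_nonneg.2 h0)]
      rw [Rat.cast_def, ← h1, Int.cast_natCast]
    have h := abs_natDiv_sub_le_one (q.num.toNat * N) q.den q.pos
    have he : (N : ℝ) * q = ((q.num.toNat * N : ℕ) : ℝ) / q.den := by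
      rw [hqr]; push_cast; ring
    rw [← he] at h
    rw [hc, abs_le]
    constructor <;> linarith [h.1, h.2]
  · obtain ⟨b, hb⟩ := ratCode_of_neg h0
    have hc : copies N (ratCode q) = 0 := by
      simp [copies, hb, Nat.add_mod]
    have hq0 : (q : ℝ) ≤ 0 := by exact_mod_cast h0.le
    have h1 : (N : ℝ) * q ≤ 0 := mul_nonpos_of_nonneg_of_nonpos (Nat.cast_nonneg _) hq0
    have h2 : 0 ≤ (N : ℝ) * r := mul_nonneg (Nat.cast_nonneg _) hr
    rw [hc, abs_le]
    constructor <;> push_cast <;> linarith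

/-! ### The approximating sequence -/

/-- The length of the blocks from which a set of size `n` is put together. -/
def blockLength (n : ℕ) : ℕ := Nat.findGreatest (fun k => k ^ 2 * 2 ^ k ≤ n) n

/-- The factor k² makes the rounding error k·2^k at most n/k. The value k = 0 always qualifies, so
the search never fails. -/
theorem blockLength_spec (n : ℕ) : blockLength n ^ 2 * 2 ^ blockLength n ≤ n :=
  Nat.findGreatest_spec (P := fun k => k ^ 2 * 2 ^ k ≤ n) (Nat.zero_le n) (by simp)

theorem le_blockLength {K n : ℕ} (h : K ^ 2 * 2 ^ K ≤ n) : K ≤ blockLength n := by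
  refine Nat.le_findGreatest (le_trans ?_ h) h
  exact (Nat.le_self_pow two_ne_zero K).trans (Nat.le_mul_of_pos_right _ (by positivity))

/-- The questions about the measure that are asked in order to find a set of size `n`. -/
def queries (n : ℕ) : List ℕ :=
  (List.range (2 ^ blockLength n)).map fun t => Nat.pair (strCode (word (blockLength n) t)) n

/-- The string of length `n` that is found from the answers to the questions `queries n`. -/
def approxString (n : ℕ) (answers : List ℕ) : List Bool :=
  fit n (blocks (fun t => copies (n / blockLength n) (answers.getI t)) (word (blockLength n))
    (2 ^ blockLength n))

theorem length_approxString (n : ℕ) (answers : List ℕ) :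
    (approxString n answers).length = n := length_fit _ _

/-- A modulus of convergence, as a function of `j` and the denominator of `ε`. -/
def modulus (j d : ℕ) : ℕ := (8 * (j + 1) * d) ^ 2 * 2 ^ (8 * (j + 1) * d)

/-- This allows the modulus to depend on ε through its denominator alone. -/
theorem inv_den_le {ε : ℚ} (hε : 0 < ε) : ((ε.den : ℝ))⁻¹ ≤ (ε : ℝ) := by
  have h1 : (1 : ℝ) ≤ ε.num := by exact_mod_cast Rat.num_pos.2 hε
  rw [Rat.cast_def, inv_eq_one_div]
  exact div_le_div_of_nonneg_right h1 (Nat.cast_nonneg _)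

open MeasureTheory in
theorem isGoodApprox_approxString {μ : Measure (ℕ → Bool)} [IsProbabilityMeasure μ]
    (hμ : MeasurePreserving shift μ μ) {f : List Bool → ℕ → ℚ} (hf : IsRepresentation μ f)
    {g : ℕ → ℕ} (hg : ∀ σ i, g (Nat.pair (strCode σ) i) = ratCode (f σ i)) {j : ℕ} {ε : ℚ}
    (hε : 0 < ε) {n : ℕ} (hn : modulus j ε.den ≤ n) :
    IsGoodApprox μ j ε n (stringSet (approxString n ((queries n).map g))) := by
  have hd := ε.pos
  have hn0 : 0 < n := lt_of_lt_of_le (by unfold modulus; positivity) hn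
  have hkK := le_blockLength hn
  have hkn := blockLength_spec n
  refine ⟨hn0, fun i hi => ?_, fun σ hσ => ?_⟩
  · have := (Finset.mem_filter.1 hi).1
    rwa [length_approxString] at this
  have hk0 : 0 < blockLength n := lt_of_lt_of_le (by positivity) hkK
  have hc : ∀ t < 2 ^ blockLength n,
      |(copies (n / blockLength n) (((queries n).map g).getI t) : ℝ) -
        (n / blockLength n : ℕ) * μ.real (cylinder (word (blockLength n) t))| ≤ 2 := by
    intro t ht
    have : ((queries n).map g).getI t = ratCode (f (word (blockLength n) t) n) := by
      rw [List.getI_eq_getElem _ (by simpa [queries] using ht)]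
      simp [queries, hg]
    rw [this]
    exact abs_copies_sub_le (Nat.div_le_self _ _) measureReal_nonneg (hf _ _)
  have hmain := abs_card_occurrences_sub_le hμ hk0 hc σ
  have hNk := Nat.div_mul_le_self n (blockLength n)
  rw [density]
  refine lt_of_lt_of_le ?_ (inv_den_le hε)
  change |(((occurrences n (stringSet (approxString n ((queries n).map g))) σ).card : ℕ) : ℝ) -
    n * μ.real (cylinder σ)| ≤ _ at hmain
  generalize (occurrences n (stringSet (approxString n ((queries n).map g))) σ).card = z at *
  generalize n / blockLength n = N at *
  generalize blockLength n = k at *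
  generalize μ.real (cylinder σ) = p at *
  generalize σ.length = l at *
  generalize ε.den = d at *
  have hn0r : (0 : ℝ) < n := by exact_mod_cast hn0
  have hk0r : (0 : ℝ) < k := by exact_mod_cast hk0
  have hd0r : (0 : ℝ) < d := by exact_mod_cast hd
  have hNkr : (N : ℝ) * k ≤ n := by exact_mod_cast hNk
  have hknr : (k : ℝ) ^ 2 * 2 ^ k ≤ n := by exact_mod_cast hkn
  have hkKr : (8 : ℝ) * (j + 1) * d ≤ k := by exact_mod_cast hkK
  have hlr : (l : ℝ) ≤ j := by exact_mod_cast hσ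
  have hl0 : (0 : ℝ) ≤ l := Nat.cast_nonneg _
  have hp1 : (1 : ℝ) ≤ 2 ^ k := one_le_pow₀ (by norm_num)
  have hk1 : (1 : ℝ) ≤ k := by exact_mod_cast hk0
  have a1 : (k : ℝ) * (k * 2 ^ k) ≤ n := by linarith [hknr, sq (k : ℝ)]
  have a2 : (k : ℝ) * k ≤ n := by nlinarith [mul_pos hk0r hk0r]
  have a3 : (k : ℝ) * 2 ^ k ≤ n := by nlinarith
  have a4 : (k : ℝ) ≤ n := by nlinarith
  -- After multiplication by k, the terms without l are at most 6n, and those with l at most (2 + 3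
  -- + 2)·n·j.
  have hE : (k : ℝ) * (4 * (k * 2 ^ k) + 2 * k + (2 * N + 3 * 2 ^ k + 2) * l) ≤
      7 * n * (j + 1) := by
    have b1 : (k : ℝ) * (2 * N + 3 * 2 ^ k + 2) ≤ 7 * n := by linarith
    have b2 := mul_le_mul b1 hlr hl0 (by positivity)
    linarith
  -- The constant 8 in `modulus` exceeds 7, which yields the strict inequality.
  have hlt : (7 : ℝ) * n * (j + 1) * d < k * n := by
    have : (0 : ℝ) < (j + 1) * d := by positivity
    nlinarith
  rw [show p - (z : ℝ) / n = -((z - n * p) / n) by field_simp; ring, abs_neg, abs_div,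
    abs_of_pos hn0r, div_lt_iff₀ hn0r, inv_mul_eq_div, lt_div_iff₀ hd0r]
  have h1 := mul_le_mul_of_nonneg_left hmain hk0r.le
  have h2 := mul_le_mul_of_nonneg_right (h1.trans hE) hd0r.le
  refine lt_of_mul_lt_mul_left ?_ hk0r.le
  linarith

/-! ### The measures of cylinders from an approximating sequence -/

/-- The number of occurrences of `σ` with wraparound in the string `s`. -/
def cyclicCount (σ s : List Bool) : ℕ :=
  ((List.range s.length).filter fun i =>
    ((List.range σ.length).map fun k => s.getD ((i + k) % s.length) false) = σ).length

theorem cyclicCount_charString (n : ℕ) (A : Finset ℕ) (σ : List Bool) :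
    cyclicCount σ (charString n A) = (occurrences n A σ).card := by
  have hlen : (charString n A).length = n := by simp [charString]
  have : occurrences n A σ = ((List.range n).filter fun i => ((List.range σ.length).map
      fun k => (charString n A).getD ((i + k) % n) false) = σ).toFinset := by
    ext i
    simp only [occurrences, Finset.mem_filter, Finset.mem_range, List.mem_toFinset,
      List.mem_filter, List.mem_range, decide_eq_true_eq]
    refine and_congr_right fun hi => ?_
    -- The default `false` is never read: residues modulo n index inside the string.
    have hget : ∀ k, (charString n A).getD ((i + k) % n) false = decide ((i + k) % n ∈ A) := by
      intro k
      have := Nat.mod_lt (i + k) (show 0 < n by omega)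
      simp [charString, this]
    simp only [hget]
    constructor
    · intro h
      refine List.ext_getElem (by simp) fun k h1 h2 => ?_
      simpa using (h ⟨k, h2⟩).symm
    · intro h k
      have := List.getElem_of_eq h.symm k.2
      simpa using this
  rw [this, List.toFinset_card_of_nodup (List.nodup_range.filter _), cyclicCount, hlen]

/-- `ratCode` requires lowest terms. An odd number over a power of two is already reduced, so its
code can be written down without computing a gcd. -/
theorem ratCode_odd_div_two_pow (a i : ℕ) :
    ratCode ((2 * a + 1 : ℕ) / 2 ^ i : ℚ) = Nat.pair (2 * (2 * a + 1)) (2 ^ i) := by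
  have hcop : Nat.Coprime (2 * a + 1) (2 ^ i) := by
    refine Nat.Coprime.pow_right _ ?_
    rw [Nat.coprime_two_right]
    exact ⟨a, rfl⟩
  have hnum := Rat.num_div_eq_of_coprime (a := ((2 * a + 1 : ℕ) : ℤ)) (b := ((2 ^ i : ℕ) : ℤ))
    (by positivity) hcop
  have hden := Rat.den_div_eq_of_coprime (a := ((2 * a + 1 : ℕ) : ℤ)) (b := ((2 ^ i : ℕ) : ℤ))
    (by positivity) hcop
  have he : ((2 * a + 1 : ℕ) / 2 ^ i : ℚ) =
      (((2 * a + 1 : ℕ) : ℤ) : ℚ) / (((2 ^ i : ℕ) : ℤ) : ℚ) := by push_cast; rfl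
  rw [ratCode_of_nonneg (by positivity), he, hnum]
  congr 1
  exact_mod_cast hden

/-- An odd numerator of a fraction with denominator `2 ^ (i + 2)` close to `z / n`. -/
def oddNumerator (i z n : ℕ) : ℕ := 2 * (z * 2 ^ (i + 1) / n) + 1

theorem ratCode_oddNumerator_div (i z n : ℕ) :
    ratCode ((oddNumerator i z n : ℚ) / 2 ^ (i + 2)) =
      Nat.pair (2 * oddNumerator i z n) (2 ^ (i + 2)) :=
  ratCode_odd_div_two_pow _ _

/-- The fraction is the midpoint of the dyadic interval of length 2^-(i+1) that contains z/n. -/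
theorem abs_div_sub_le {i z n : ℕ} (hn : 0 < n) :
    |(z : ℝ) / n - ((oddNumerator i z n : ℚ) / 2 ^ (i + 2) : ℚ)| ≤ ((2 : ℝ) ^ (i + 1))⁻¹ := by
  have h := abs_natDiv_sub_le_one (z * 2 ^ (i + 1)) n hn
  rw [oddNumerator]
  generalize z * 2 ^ (i + 1) / n = a at *
  push_cast at h ⊢
  have hP : (0 : ℝ) < 2 ^ (i + 1) := by positivity
  rw [pow_succ (2 : ℝ) (i + 1)]
  generalize (2 : ℝ) ^ (i + 1) = P at *
  have hn' : (0 : ℝ) < n := by exact_mod_cast hn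
  rw [mul_div_right_comm] at h
  generalize (z : ℝ) / n = r at *
  have : r - (2 * a + 1) / (P * 2) = (r * P - a - 1 / 2) * P⁻¹ := by field_simp; ring
  rw [this, abs_mul, abs_of_pos (inv_pos.2 hP)]
  refine mul_le_of_le_one_left (inv_pos.2 hP).le ?_
  rw [abs_le]
  constructor <;> linarith [h.1, h.2]

theorem ratCode_inv_two_pow (i : ℕ) : ratCode (((2 : ℚ) ^ i)⁻¹) = Nat.pair 2 (2 ^ i) := by
  have := ratCode_odd_div_two_pow 0 i
  simpa using this

/-- The value at `(σ, i)` of the representation of the measure that is found from a modulus `m`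
and a sequence `A` of approximations. -/
def approxMeasure (m : ℕ → {ε : ℚ // 0 < ε} → ℕ) (A : ℕ → Finset ℕ) (σ : List Bool) (i : ℕ) : ℚ :=
  let n := m σ.length ⟨((2 : ℚ) ^ (i + 1))⁻¹, by positivity⟩
  oddNumerator i (occurrences n (A n) σ).card n / 2 ^ (i + 2)

theorem isRepresentation_approxMeasure {μ : MeasureTheory.Measure (ℕ → Bool)}
    {m : ℕ → {ε : ℚ // 0 < ε} → ℕ} {A : ℕ → Finset ℕ} (h : IsGoodSequence μ m A) :
    IsRepresentation μ (approxMeasure m A) := by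
  intro σ i
  rw [approxMeasure]
  obtain ⟨hn, -, hg⟩ := h.2 σ.length ⟨((2 : ℚ) ^ (i + 1))⁻¹, by positivity⟩ _ le_rfl
  have h1 := hg σ le_rfl
  generalize m σ.length ⟨((2 : ℚ) ^ (i + 1))⁻¹, by positivity⟩ = n at *
  have h2 := abs_div_sub_le (i := i) (z := (occurrences n (A n) σ).card) hn
  rw [density] at h1
  -- Half of the tolerance goes to the density, with strict inequality, and half to dyadic rounding.
  have h3 : ((2 : ℝ) ^ i)⁻¹ = ((2 : ℝ) ^ (i + 1))⁻¹ + ((2 : ℝ) ^ (i + 1))⁻¹ := by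
    rw [pow_succ]; field_simp; norm_num
  rw [h3]
  push_cast at h1
  exact (abs_sub_le _ _ _).trans_lt (add_lt_add_of_lt_of_le h1 h2)

/-! ### Computability of the constructions -/

theorem primrec_pow : Primrec₂ fun a b : ℕ => a ^ b :=
  Primrec₂.unpaired'.1 Nat.Primrec.pow

theorem primrec_word : Primrec₂ word := by
  have hbit : Primrec₂ fun (p : ℕ × ℕ) (b : ℕ) => p.2.testBit b := by
    have : PrimrecRel fun (p : ℕ × ℕ) (b : ℕ) => p.2 / 2 ^ b % 2 = 1 :=
      Primrec.eq.comp
        (Primrec.nat_mod.comp (Primrec.nat_div.comp (Primrec.snd.comp Primrec.fst)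
          (primrec_pow.comp (Primrec.const 2) Primrec.snd)) (Primrec.const 2))
        (Primrec.const 1)
    exact this.decide.of_eq fun p => by simp [Nat.testBit_eq_decide_div_mod_eq]
  exact Primrec.list_map (Primrec.list_range.comp Primrec.fst) hbit

theorem primrec_fit : Primrec₂ fit :=
  Primrec.list_take.comp Primrec.fst (Primrec.list_append.comp Primrec.snd
    (Primrec.list_map (Primrec.list_range.comp Primrec.fst) (Primrec.const false)))

theorem primrec_copies : Primrec₂ copies := by
  have h1 : Primrec fun p : ℕ × ℕ => p.2.unpair.1 :=
    Primrec.fst.comp (Primrec.unpair.comp Primrec.snd)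
  have h2 : Primrec fun p : ℕ × ℕ => p.2.unpair.2 :=
    Primrec.snd.comp (Primrec.unpair.comp Primrec.snd)
  exact Primrec.ite (Primrec.eq.comp (Primrec.nat_mod.comp h1 (Primrec.const 2)) (Primrec.const 0))
    (Primrec.nat_div.comp (Primrec.nat_mul.comp
      (Primrec.nat_div.comp h1 (Primrec.const 2)) Primrec.fst) h2) (Primrec.const 0)

theorem primrec_blocks {α : Type*} [Primcodable α] {c : α → ℕ → ℕ} {w : α → ℕ → List Bool}
    {K : α → ℕ} (hc : Primrec₂ c) (hw : Primrec₂ w) (hK : Primrec K) :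
    Primrec fun a => blocks (c a) (w a) (K a) :=
  Primrec.list_flatMap (Primrec.list_range.comp hK)
    (Primrec.list_flatMap (Primrec.list_range.comp hc) (hw.comp (Primrec.fst.comp Primrec.fst) (Primrec.snd.comp Primrec.fst)))

theorem primrec_blockLength : Primrec blockLength := by
  have h : PrimrecRel fun n k : ℕ => k ^ 2 * 2 ^ k ≤ n :=
    Primrec.nat_le.comp (Primrec.nat_mul.comp (primrec_pow.comp Primrec.snd (Primrec.const 2))
      (primrec_pow.comp (Primrec.const 2) Primrec.snd)) Primrec.fst
  exact Primrec.nat_findGreatest Primrec.id h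

theorem primrec_strCode : Primrec strCode := Primrec.encode

theorem primrec_queries : Primrec queries :=
  Primrec.list_map (Primrec.list_range.comp
    (primrec_pow.comp (Primrec.const 2) primrec_blockLength))
    (Primrec₂.natPair.comp (primrec_strCode.comp
      (primrec_word.comp (primrec_blockLength.comp Primrec.fst) Primrec.snd)) Primrec.fst)

theorem primrec_approxString : Primrec₂ approxString := by
  have hk : Primrec fun p : ℕ × List ℕ => blockLength p.1 := primrec_blockLength.comp Primrec.fst
  refine primrec_fit.comp Primrec.fst (primrec_blocks ?_ ?_
    (primrec_pow.comp (Primrec.const 2) hk))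
  · exact primrec_copies.comp (Primrec.nat_div.comp (Primrec.fst.comp Primrec.fst) (hk.comp Primrec.fst))
      (Primrec.list_getI.comp (Primrec.snd.comp Primrec.fst) Primrec.snd)
  · exact primrec_word.comp (hk.comp Primrec.fst) Primrec.snd

theorem primrec_modulus : Primrec₂ modulus := by
  have h : Primrec fun p : ℕ × ℕ => 8 * (p.1 + 1) * p.2 :=
    Primrec.nat_mul.comp (Primrec.nat_mul.comp (Primrec.const 8)
      (Primrec.succ.comp Primrec.fst)) Primrec.snd
  exact Primrec.nat_mul.comp (primrec_pow.comp h (Primrec.const 2))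
    (primrec_pow.comp (Primrec.const 2) h)

theorem primrec_cyclicCount : Primrec₂ cyclicCount := by
  have hget : Primrec₂ fun (x : ℕ × List Bool × List Bool) (k : ℕ) =>
      x.2.2.getD ((x.1 + k) % x.2.2.length) false := by
    have hs : Primrec fun q : (ℕ × List Bool × List Bool) × ℕ => q.1.2.2 :=
      Primrec.snd.comp (Primrec.snd.comp Primrec.fst)
    exact (Primrec.list_getD false).comp hs (Primrec.nat_mod.comp
      (Primrec.nat_add.comp (Primrec.fst.comp Primrec.fst) Primrec.snd) (Primrec.list_length.comp hs))
  have hrel : PrimrecRel fun (i : ℕ) (p : List Bool × List Bool) =>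
      (List.range p.1.length).map (fun k => p.2.getD ((i + k) % p.2.length) false) = p.1 :=
    Primrec.eq.comp (Primrec.list_map (Primrec.list_range.comp
      (Primrec.list_length.comp (Primrec.fst.comp Primrec.snd))) hget) (Primrec.fst.comp Primrec.snd)
  exact Primrec.list_length.comp (hrel.listFilter.comp
    (Primrec.list_range.comp (Primrec.list_length.comp Primrec.snd)) Primrec.id)

theorem primrec_oddNumerator : Primrec fun p : ℕ × ℕ × ℕ => oddNumerator p.1 p.2.1 p.2.2 :=
  Primrec.nat_double_succ.comp (Primrec.nat_div.comp
    (Primrec.nat_mul.comp (Primrec.fst.comp Primrec.snd)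
      (primrec_pow.comp (Primrec.const 2) (Primrec.succ.comp Primrec.fst)))
    (Primrec.snd.comp Primrec.snd))

/-- The code of the rational number found from the strings `p.1` and `p.2.2` at precision
`p.2.1`. -/
def densityCode (σ : List Bool) (i : ℕ) (s : List Bool) : ℕ :=
  Nat.pair (2 * oddNumerator i (cyclicCount σ s) s.length) (2 ^ (i + 2))

theorem primrec_densityCode :
    Primrec fun p : (List Bool × ℕ) × List Bool => densityCode p.1.1 p.1.2 p.2 := by
  have hi : Primrec fun p : (List Bool × ℕ) × List Bool => p.1.2 := Primrec.snd.comp Primrec.fst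
  exact Primrec₂.natPair.comp (Primrec.nat_double.comp (primrec_oddNumerator.comp
    (hi.pair ((primrec_cyclicCount.comp (Primrec.fst.comp Primrec.fst) Primrec.snd).pair
      (Primrec.list_length.comp Primrec.snd)))))
    (primrec_pow.comp (Primrec.const 2) (Primrec.nat_add.comp hi (Primrec.const 2)))

theorem coe_eq_some_iff {g : ℕ → ℕ} {x y : ℕ} : (g : ℕ →. ℕ) x = Part.some y ↔ g x = y := by
  rw [PFun.coe_val, Part.some_inj]

/-- The questions depend on n only and not on earlier answers, so they can all be asked in one batch
between two primitive recursive steps. -/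
theorem exists_code_approxString :
    ∃ c : OracleCode, ∀ g n,
      c.eval g n = Part.some (strCode (approxString n ((queries n).map g))) := by
  obtain ⟨c, hc⟩ := (UniformlyComputable.of_computable primrec_approxString.to_comp).comp
    ((UniformlyComputable.of_computable Computable.id).pair
      (UniformlyComputable.list_map_oracle.comp
        (UniformlyComputable.of_computable primrec_queries.to_comp)))
  exact ⟨c, hc⟩

/-- The size of the set that is used for the measure of `[σ]` at precision `i`, obtained from an
oracle. -/
def querySize (g : ℕ → ℕ) (σ : List Bool) (i : ℕ) : ℕ :=
  g (2 * Nat.pair σ.length (Nat.pair 2 (2 ^ (i + 1))))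

/-- Here the second question depends on the first: an even argument asks for n = m(|σ|, 2^-(i+1)),
with `Nat.pair 2 (2 ^ (i + 1))` coding the tolerance, and the odd argument 2n + 1 then asks for A_n.
The default `[]` only makes decoding total for arbitrary oracles. -/
theorem exists_code_densityCode :
    ∃ c : OracleCode, ∀ g σ i, c.eval g (Nat.pair (strCode σ) i) =
      Part.some (densityCode σ i
        ((Encodable.decode (α := List Bool) (g (2 * querySize g σ i + 1))).getD [])) := by
  have hq : Primrec fun p : List Bool × ℕ =>
      2 * Nat.pair p.1.length (Nat.pair 2 (2 ^ (p.2 + 1))) :=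
    Primrec.nat_double.comp (Primrec₂.natPair.comp (Primrec.list_length.comp Primrec.fst)
      (Primrec₂.natPair.comp (Primrec.const 2)
        (primrec_pow.comp (Primrec.const 2) (Primrec.succ.comp Primrec.snd))))
  have hdec : Primrec fun n : ℕ => (Encodable.decode (α := List Bool) n).getD [] :=
    Primrec.option_getD.comp Primrec.decode (Primrec.const [])
  obtain ⟨c, hc⟩ := (UniformlyComputable.of_computable primrec_densityCode.to_comp).comp
    ((UniformlyComputable.of_computable Computable.id).pair
      ((UniformlyComputable.of_computable hdec.to_comp).comp
        (UniformlyComputable.oracle.comp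
          ((UniformlyComputable.of_computable Primrec.nat_double_succ.to_comp).comp
            (UniformlyComputable.oracle.comp (UniformlyComputable.of_computable hq.to_comp))))))
  exact ⟨c, fun g σ i => hc g (σ, i)⟩

end CantorApprox

/-! ### The two directions of the theorem -/

theorem theorem4p1 :
    (∃ m : ℕ → {ε : ℚ // 0 < ε} → ℕ,
      (∃ F : ℕ →. ℕ, Nat.Partrec F ∧ CantorApprox.CodesModulus F m) ∧
      ∃ c : CantorApprox.OracleCode,
        ∀ (μ : MeasureTheory.Measure (ℕ → Bool)), MeasureTheory.IsProbabilityMeasure μ →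
          MeasureTheory.MeasurePreserving CantorApprox.shift μ μ →
          ∀ f : List Bool → ℕ → ℚ, CantorApprox.IsRepresentation μ f →
          ∀ g : ℕ → ℕ, CantorApprox.CodesRepresentation (g : ℕ →. ℕ) f →
            ∃ A : ℕ → Finset ℕ, CantorApprox.CodesSequence (c.eval g) A ∧
              CantorApprox.IsGoodSequence μ m A) ∧
    (∃ c : CantorApprox.OracleCode,
      ∀ (μ : MeasureTheory.Measure (ℕ → Bool)), MeasureTheory.IsProbabilityMeasure μ →
        ∀ (m : ℕ → {ε : ℚ // 0 < ε} → ℕ) (A : ℕ → Finset ℕ), CantorApprox.IsGoodSequence μ m A →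
        ∀ g h : ℕ → ℕ, CantorApprox.CodesModulus (g : ℕ →. ℕ) m →
          CantorApprox.CodesSequence (h : ℕ →. ℕ) A →
          ∃ f : List Bool → ℕ → ℚ, CantorApprox.IsRepresentation μ f ∧
            CantorApprox.CodesRepresentation (c.eval (CantorApprox.joinOracle g h)) f) := by
  open CantorApprox in
  refine ⟨⟨fun j ε => modulus j ε.1.den,
    -- The second component of the code of ε is its denominator.
    ⟨fun p => Part.some (modulus p.unpair.1 p.unpair.2.unpair.2), ?_, fun j ε => ?_⟩, ?_⟩, ?_⟩
  · refine Partrec.nat_iff.1 (Computable.partrec (f := fun p : ℕ =>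
      modulus p.unpair.1 p.unpair.2.unpair.2) (Primrec.to_comp ?_))
    exact primrec_modulus.comp (Primrec.fst.comp Primrec.unpair)
      (Primrec.snd.comp (Primrec.unpair.comp (Primrec.snd.comp Primrec.unpair)))
  · simp [ratCode]
  · obtain ⟨c, hc⟩ := exists_code_approxString
    refine ⟨c, fun μ _ hμ f hf g hg =>
      ⟨fun n => stringSet (approxString n ((queries n).map g)), fun n => ?_, fun n i hi => ?_,
        fun j ε n hn => isGoodApprox_approxString hμ hf (fun σ i => coe_eq_some_iff.1 (hg σ i))
          ε.2 hn⟩⟩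
    · have := charString_stringSet (approxString n ((queries n).map g))
      rw [length_approxString] at this
      rw [hc, this]
    · have := (Finset.mem_filter.1 hi).1
      rwa [length_approxString] at this
  · obtain ⟨c, hc⟩ := exists_code_densityCode
    refine ⟨c, fun μ _ m A hA g h hg hh =>
      ⟨approxMeasure m A, isRepresentation_approxMeasure hA, fun σ i => ?_⟩⟩
    have hsize : querySize (joinOracle g h) σ i =
        m σ.length ⟨((2 : ℚ) ^ (i + 1))⁻¹, by positivity⟩ := by
      have := coe_eq_some_iff.1 (hg σ.length ⟨((2 : ℚ) ^ (i + 1))⁻¹, by positivity⟩)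
      rw [← this, ratCode_inv_two_pow, querySize, joinOracle, if_pos (by omega)]
      congr 1
      omega
    have hset : ∀ n, joinOracle g h (2 * n + 1) = strCode (charString n (A n)) := by
      intro n
      rw [← coe_eq_some_iff.1 (hh n), joinOracle, if_neg (by omega)]
      congr 1
      omega
    rw [hc, hset, hsize, strCode, Encodable.encodek, Option.getD_some, densityCode,
      cyclicCount_charString, approxMeasure, ratCode_oddNumerator_div]
    -- It remains to see that the program, which uses the length of the string received, divides by
    -- the right n.
    simp [charString]
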